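/- Let $k$ be an algebraically closed field of arbitrary characteristic; varieties are algebraic varieties over $k$ (reduced, separated, of finite type, not necessarily irreducible), and points are closed points, i.e. $k$-points. Let $X$ be an irreducible variety and $\mathrm{Aut}(X)$ its group of automorphisms over $k$. A *family* $\{\varphi_t\}_{t\in T}$ in $\mathrm{Aut}(X)$ is a map $T\to\mathrm{Aut}(X)$, $t\mapsto\varphi_t$, where $T$ is an irreducible variety; put $\varphi_T=\{\varphi_t\mid t\in T\}$. It is *unital* if $\mathrm{id}_X\in\varphi_T$, and *algebraic* if $T\times X\to X$, $(t,x)\mapsto\varphi_t(x)$, is a morphism. Its *inverse* is $\{\varphi_t^{-1}\}_{t\in T}$. The *product* of a finite (nonempty) sequence of families $\{\varphi_t\}_{t\in T},\dots,\{\psi_s\}_{s\in S}$ is the family $\{\varphi_t\circ\cdots\circ\psi_s\}_{(t,\dots,s)\in T\times\cdots\times S}$. A family is *derived* from a collection $\mathcal I$ of families if it is a product of families each of which is a member of $\mathcal I$ or the inverse of a member of $\mathcal I$. The group *generated* by a nonempty collection $\mathcal I$ is the subgroup of $\mathrm{Aut}(X)$ generated by $\bigcup\varphi_T$, the union being over all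 $\{\varphi_t\}_{t\in T}$ in $\mathcal I$. **Theorem.** Let $\mathcal I$ be a nonempty collection of unital algebraic families in $\mathrm{Aut}(X)$, let $G\subseteq\mathrm{Aut}(X)$ be the subgroup generated by $\mathcal I$, and let $Y$ be a $G$-invariant locally closed subvariety of $X$. Then there is a family $\{\varphi_t\}_{t\in T}$ derived from $\mathcal I$ that is exhaustive for the natural action of $G$ on $Y$, that is, $\varphi_T\subseteq G$ and $$G(y)=\{\varphi_t(y)\mid t\in T\}\quad\text{for every point } y\in Y.$$ -/

import Mathlib

open CategoryTheory AlgebraicGeometry Limits MonoidalCategory CartesianMonoidalCategory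

open scoped TensorProduct

universe u

namespace AutFamilies

/-! ## Products of varieties over an algebraically closed field -/

theorem isReduced_tensorProduct (k A B : Type*) [Field k] [IsAlgClosed k] [CommRing A] [CommRing B]
    [Algebra k A] [Algebra k B] [Algebra.FiniteType k A] [IsReduced A] [IsReduced B] :
    IsReduced (A ⊗[k] B) := by
  let b := Module.Basis.ofVectorSpace k B
  let bA := Algebra.TensorProduct.basis A b
  refine ⟨fun u hu => bA.ext_elem fun i => ?_⟩
  have hjac : IsJacobsonRing A := isJacobsonRing_of_finiteType (A := k)
  have hbot : (⊥ : Ideal A).jacobson = ⊥ :=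
    hjac.out (Ideal.isRadical_iff_quotient_reduced _ |>.2
      (isReduced_of_injective _ (RingEquiv.quotientBot A).injective))
  rw [map_zero, Finsupp.coe_zero, Pi.zero_apply, ← Ideal.mem_bot, ← hbot, Ideal.jacobson,
    Submodule.mem_sInf]
  rintro m ⟨-, hm⟩
  let _ := Ideal.Quotient.field m
  have : Module.Finite k (A ⧸ m) := finite_of_finite_type_of_isJacobsonRing k (A ⧸ m)
  have hbij := IsAlgClosed.algebraMap_bijective_of_isIntegral (k := k) (K := A ⧸ m)
  let e : k ≃ₐ[k] A ⧸ m := AlgEquiv.ofBijective (Algebra.ofId k (A ⧸ m)) hbij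
  let f : A →ₐ[k] k := e.symm.toAlgHom.comp (Ideal.Quotient.mkₐ k m)
  let φ : A ⊗[k] B →ₐ[k] B :=
    Algebra.TensorProduct.lift ((Algebra.ofId k B).comp f) (AlgHom.id k B) fun _ _ => .all _ _
  have hφ : φ u = 0 := (hu.map φ).eq_zero
  have hrep : φ u = (bA.repr u).sum fun i a => f a • b i := by
    conv_lhs => rw [← bA.linearCombination_repr u]
    rw [Finsupp.linearCombination_apply, Finsupp.sum, map_sum, Finsupp.sum]
    refine Finset.sum_congr rfl fun j _ => ?_
    simp [bA, φ, Algebra.TensorProduct.basis_apply, Algebra.smul_def,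
      Algebra.ofId_apply]
  have hc : f (bA.repr u i) = 0 := by
    have h2 : b.repr (φ u) i = f (bA.repr u i) := by
      have h3 : b.repr (φ u) = (bA.repr u).mapRange f (map_zero f) := by
        rw [hrep, Finsupp.sum, map_sum]
        refine Finsupp.ext fun j => ?_
        rw [Finsupp.finsetSum_apply, Finsupp.mapRange_apply,
          Finset.sum_eq_single j (fun l _ hl => by simp [Finsupp.single_eq_of_ne' hl])
            (fun h => by simp [Finsupp.notMem_support_iff.1 h])]
        simp
      rw [h3, Finsupp.mapRange_apply]
    rw [← h2, hφ, map_zero, Finsupp.zero_apply]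
  have : Ideal.Quotient.mk m (bA.repr u i) = 0 := by
    simpa [f] using hc
  exact Ideal.Quotient.eq_zero_iff_mem.1 this

section Products

variable {k : Type u} [Field k] [IsAlgClosed k]

theorem isReduced_pullback_spec {A B : CommRingCat.{u}} (f : Spec A ⟶ Spec (.of k))
    (g : Spec B ⟶ Spec (.of k)) [LocallyOfFiniteType f] [IsReduced (Spec A)] [IsReduced (Spec B)] :
    IsReduced (pullback f g) := by
  obtain ⟨f, rfl⟩ := Spec.map_surjective f
  obtain ⟨g, rfl⟩ := Spec.map_surjective g
  let _ : Algebra k A := f.hom.toAlgebra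
  let _ : Algebra k B := g.hom.toAlgebra
  have hft : f.hom.FiniteType :=
    (HasRingHomProperty.Spec_iff (P := @LocallyOfFiniteType)).1 ‹_›
  have : Algebra.FiniteType k A := hft
  have : _root_.IsReduced A := (affine_isReduced_iff A).1 inferInstance
  have : _root_.IsReduced B := (affine_isReduced_iff B).1 inferInstance
  have : _root_.IsReduced (A ⊗[k] B) := isReduced_tensorProduct k A B
  have : IsReduced (Spec (.of (A ⊗[k] B))) := inferInstance
  exact isReduced_of_isOpenImmersion (pullbackSpecIso k A B).hom

theorem isReduced_pullback {T S : Scheme.{u}} (f : T ⟶ Spec (.of k)) (g : S ⟶ Spec (.of k))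
    [LocallyOfFiniteType f] [IsReduced T] [IsReduced S] : IsReduced (pullback f g) := by
  have (i : T.affineOpenCover.openCover.I₀) : LocallyOfFiniteType (T.affineOpenCover.f i ≫ f) :=
    inferInstanceAs (LocallyOfFiniteType (T.affineOpenCover.openCover.f i ≫ f))
  have (i : T.affineOpenCover.openCover.I₀) : IsReduced (Spec (T.affineOpenCover.X i)) :=
    inferInstanceAs (IsReduced (T.affineOpenCover.openCover.X i))
  have (i : S.affineOpenCover.openCover.I₀) : IsReduced (Spec (S.affineOpenCover.X i)) :=
    inferInstanceAs (IsReduced (S.affineOpenCover.openCover.X i))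
  have := fun ij : T.affineOpenCover.openCover.I₀ × S.affineOpenCover.openCover.I₀ =>
    isReduced_pullback_spec (T.affineOpenCover.f ij.1 ≫ f) (S.affineOpenCover.f ij.2 ≫ g)
  exact @IsReduced.of_openCover _ (Scheme.Pullback.openCoverOfLeftRight
    T.affineOpenCover.openCover S.affineOpenCover.openCover f g) this

theorem irreducibleSpace_pullback {T S : Scheme.{u}} (f : T ⟶ Spec (.of k)) (g : S ⟶ Spec (.of k))
    [LocallyOfFiniteType f] [IrreducibleSpace T] [IrreducibleSpace S] :
    IrreducibleSpace ↥(pullback f g) := by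
  have hJ : JacobsonSpace T := LocallyOfFiniteType.jacobsonSpace (Y := Spec _) f
  have hop : IsOpenMap (pullback.fst f g) := (pullback.fst f g).isOpenMap
  have hsurj : Function.Surjective (pullback.fst f g) := by
    rw [← Set.range_eq_univ, Scheme.Pullback.range_fst, Set.eq_univ_iff_forall]
    intro t
    obtain ⟨s⟩ := (inferInstance : Nonempty S)
    exact ⟨s, Subsingleton.elim (α := PrimeSpectrum k) _ _⟩
  have hne : Nonempty ↥(pullback f g) := by
    obtain ⟨t⟩ := (inferInstance : Nonempty T)
    exact ⟨(hsurj t).choose⟩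
  have hpre : PreirreducibleSpace ↥(pullback f g) := by
    refine ⟨?_⟩
    rintro U V hU hV ⟨u, -, hu⟩ ⟨v, -, hv⟩
    obtain ⟨t, ⟨⟨u', hu', hut⟩, ⟨v', hv', hvt⟩⟩, ht⟩ := nonempty_inter_closedPoints
      (nonempty_preirreducible_inter (hop U hU) (hop V hV) ⟨_, u, hu, rfl⟩ ⟨_, v, hv, rfl⟩)
      ((hop U hU).inter (hop V hV)).isLocallyClosed
    let p := pointOfClosedPoint f t ht
    have hp : p ≫ f = 𝟙 _ := pointOfClosedPoint_comp f t ht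
    let σ : S ⟶ pullback f g := pullback.lift (g ≫ p) (𝟙 S) (by simp [hp])
    have hσ : ∀ w : ↥(pullback f g), pullback.fst f g w = t → w ∈ Set.range σ := by
      intro w hw
      have hpb : IsPullback σ g (pullback.fst f g) p := by
        refine IsPullback.of_right (h₁₂ := pullback.snd f g) (h₂₂ := f) (v₁₃ := g) ?_
          (pullback.lift_fst _ _ _) (IsPullback.of_hasPullback f g).flip
        rw [hp, show σ ≫ pullback.snd f g = 𝟙 S from pullback.lift_snd _ _ _]
        exact IsPullback.of_horiz_isIso ⟨by simp⟩
      have hr : w ∈ Set.range (pullback.fst (pullback.fst f g) p) := by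
        rw [Scheme.Pullback.range_fst]
        exact ⟨IsLocalRing.closedPoint k, by rw [hw]; exact pointOfClosedPoint_apply f t ht _⟩
      obtain ⟨z, rfl⟩ := hr
      refine ⟨hpb.isoPullback.inv z, ?_⟩
      rw [← Scheme.Hom.comp_apply, hpb.isoPullback_inv_fst]
    obtain ⟨a, ha⟩ := hσ u' hut
    obtain ⟨b, hb⟩ := hσ v' hvt
    obtain ⟨c, hc, hc'⟩ := nonempty_preirreducible_inter (hU.preimage σ.continuous)
      (hV.preimage σ.continuous) ⟨a, by simpa [ha] using hu'⟩ ⟨b, by simpa [hb] using hv'⟩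
    exact ⟨σ c, trivial, hc, hc'⟩
  exact ⟨hne⟩

end Products

/-! ## Varieties and their points -/

section Definitions

variable {k : Type u} [Field k]

/-- A variety over `k` (used for `k` algebraically closed): a reduced separated `k`-scheme of
finite type. -/
class IsVariety (X : Over (Spec (.of k))) : Prop where
  isReduced : IsReduced X.left
  isSeparated : IsSeparated X.hom
  locallyOfFiniteType : LocallyOfFiniteType X.hom
  quasiCompact : QuasiCompact X.hom

attribute [instance] IsVariety.isReduced IsVariety.isSeparated IsVariety.locallyOfFiniteType
  IsVariety.quasiCompact

/-- The product of two varieties is a variety. -/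
theorem isVariety_tensorObj [IsAlgClosed k] {T S : Over (Spec (.of k))} (hT : IsVariety T)
    (hS : IsVariety S) : IsVariety (T ⊗ S) where
  isReduced := isReduced_pullback T.hom S.hom
  isSeparated := inferInstanceAs (IsSeparated (pullback.fst T.hom S.hom ≫ T.hom))
  locallyOfFiniteType := inferInstanceAs (LocallyOfFiniteType (pullback.fst T.hom S.hom ≫ T.hom))
  quasiCompact := inferInstanceAs (QuasiCompact (pullback.fst T.hom S.hom ≫ T.hom))

/-- The product of two irreducible varieties is irreducible. -/
theorem irreducibleSpace_tensorObj [IsAlgClosed k] {T S : Over (Spec (.of k))} (hT : IsVariety T)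
    (hT' : IrreducibleSpace T.left) (hS' : IrreducibleSpace S.left) :
    IrreducibleSpace (T ⊗ S).left :=
  irreducibleSpace_pullback T.hom S.hom

/-- The points of a variety in the classical sense: its `k`-points, which for `k` algebraically
closed are the same as the closed points of the scheme. -/
abbrev Pt (X : Over (Spec (.of k))) : Type u := Over.mk (𝟙 (Spec (.of k))) ⟶ X

/-- The point of the underlying scheme given by a `k`-point. -/
noncomputable def Pt.toPoint {X : Over (Spec (.of k))} (x : Pt X) : X.left :=
  x.left (IsLocalRing.closedPoint k)

/-- The Zariski topology on the set of `k`-points. -/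
noncomputable instance Pt.instTopologicalSpace (X : Over (Spec (.of k))) : TopologicalSpace (Pt X) :=
  TopologicalSpace.induced Pt.toPoint inferInstance

/-- The natural action of `Aut(X)` (automorphisms over `k`, with `g * h = g ∘ h`) on the points of
`X`: `g • x = g(x)`. -/
noncomputable instance Pt.instMulAction (X : Over (Spec (.of k))) : MulAction (Aut X) (Pt X) where
  smul g x := x ≫ g.hom
  one_smul x := Category.comp_id x
  mul_smul g h x := (Category.assoc x h.hom g.hom).symm

/-! ## Families of automorphisms -/

/-- A family `{φ_t}_{t ∈ T}` in `Aut(X)` parameterized by an irreducible variety `T`: an arbitrary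
map from the points of `T` to `Aut(X)`. -/
structure Family (X : Over (Spec (.of k))) where
  T : Over (Spec (.of k))
  isVariety : IsVariety T
  irreducible : IrreducibleSpace T.left
  φ : Pt T → Aut X

namespace Family

variable {X : Over (Spec (.of k))}

/-- The family is unital: it contains the identity. -/
def IsUnital (F : Family X) : Prop := 1 ∈ Set.range F.φ

/-- The family is algebraic: `T × X → X`, `(t, x) ↦ φ_t(x)`, is a morphism of varieties. -/
def IsAlgebraic (F : Family X) : Prop :=
  ∃ Φ : F.T ⊗ X ⟶ X, ∀ (t : Pt F.T) (x : Pt X), lift t x ≫ Φ = F.φ t • x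

/-- The inverse family `{φ_t⁻¹}_{t ∈ T}`. -/
noncomputable def inverse (F : Family X) : Family X where
  T := F.T
  isVariety := F.isVariety
  irreducible := F.irreducible
  φ t := (F.φ t)⁻¹

/-- The subgroup of `Aut(X)` generated by a collection of families. -/
noncomputable def generatedGroup (I : Set (Family X)) : Subgroup (Aut X) :=
  Subgroup.closure (⋃ F ∈ I, Set.range F.φ)

/-- `F` is a family in `G` that is exhaustive for the natural action of `G` on `Y`:
`G(y) = φ_T(y)` for every `y ∈ Y`. -/
def IsExhaustive (G : Subgroup (Aut X)) (Y : Set (Pt X)) (F : Family X) : Prop :=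
  (∀ t, F.φ t ∈ G) ∧
    ∀ y ∈ Y, MulAction.orbit G y = (fun g : Aut X => g • y) '' Set.range F.φ

variable [IsAlgClosed k]

/-- The product `{φ_t ∘ ψ_s}_{(t, s) ∈ T × S}` of two families. -/
noncomputable def prod (F F' : Family X) : Family X where
  T := F.T ⊗ F'.T
  isVariety := isVariety_tensorObj F.isVariety F'.isVariety
  irreducible := irreducibleSpace_tensorObj F.isVariety F.irreducible F'.irreducible
  φ p := F.φ (p ≫ fst F.T F'.T) * F'.φ (p ≫ snd F.T F'.T)

/-- The product `{φ_t ∘ ⋯ ∘ ψ_s}_{(t, …, s) ∈ T × ⋯ × S}` of the finite sequence of families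
consisting of `F` followed by the members of a list. -/
noncomputable def seqProd : Family X → List (Family X) → Family X
  | F, [] => F
  | F, F' :: l => F.prod (seqProd F' l)

/-- A family is derived from `I` if it is a product of a (nonempty) finite sequence of families
each of which is a member of `I` or the inverse of a member of `I`. -/
def IsDerivedFrom (I : Set (Family X)) (F : Family X) : Prop :=
  ∃ (F₀ : Family X) (l : List (Family X)),
    (∀ H ∈ F₀ :: l, H ∈ I ∨ ∃ H' ∈ I, H = H'.inverse) ∧ F = seqProd F₀ l

end Family

end Definitions

end AutFamilies

/-!
Exhaustiveness is a condition on each point separately, so it suffices to treat `Y = X`, and by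
Noetherian induction to exhaust the orbits of the points of a nonempty open part of each irreducible
closed `U ⊆ X`.

For a product `{φ_t}` of members of `I`, the pairs `(x, φ_t(x))` with `x ∈ U` form an irreducible
constructible subset of `X × X`. Since the families are unital, these sets are directed under
inclusion, so the ascending chain condition on irreducible closed sets yields a product `F₀` whose
pairs are dense in all of them. The closure `Z` of this dense set is mapped into itself by every
`g` in a member of `I` acting on the second factor, hence onto itself since `X × X` is Noetherian,
and so it contains `(x, g(x))` for all `x ∈ U` and `g ∈ G`. By Chevalley's theorem `F₀` realizes all
pairs in a nonempty open part `Z ∩ W` of `Z`. The translates of `W` under `G` have the same union as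
finitely many of them, and multiplying `F₀` by a derived family containing the finitely many
translating elements realizes all pairs of `Z` in that union.

The dense set is built from products of members of `I` only, because the inverse of an algebraic
family need not be algebraic a priori; inverses enter through the translating elements.
-/

namespace AutFamilies

open Topology TopologicalSpace
open scoped Pointwise

/-! ## Constructible, irreducible and closed sets -/

section Topology

variable {α β γ : Type*} [TopologicalSpace α] [TopologicalSpace β] [TopologicalSpace γ]

theorem exists_isOpen_inter_subset_or_subset_compl {s Z : Set α} (hs : IsConstructible s)
    (hZ : IsIrreducible Z) : ∃ V, IsOpen V ∧ (Z ∩ V).Nonempty ∧ (Z ∩ V ⊆ s ∨ Z ∩ V ⊆ sᶜ) := by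
  induction hs using IsConstructible.empty_union_induction with
  | open_retrocompact U hU _ =>
    rcases (Z ∩ U).eq_empty_or_nonempty with hZU | hZU
    · refine ⟨Set.univ, isOpen_univ, by simpa only [Set.inter_univ] using hZ.nonempty, .inr ?_⟩
      rwa [Set.inter_univ, Set.subset_compl_iff_disjoint_right, Set.disjoint_iff_inter_eq_empty]
    · exact ⟨U, hU, hZU, .inl Set.inter_subset_right⟩
  | union s _ t _ hs ht =>
    obtain ⟨V, hV, hZV, hVs | hVs⟩ := hs
    · exact ⟨V, hV, hZV, .inl (hVs.trans Set.subset_union_left)⟩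
    obtain ⟨W, hW, hZW, hWt | hWt⟩ := ht
    · exact ⟨W, hW, hZW, .inl (hWt.trans Set.subset_union_right)⟩
    refine ⟨V ∩ W, hV.inter hW, hZ.isPreirreducible V W hV hW hZV hZW, .inr ?_⟩
    rw [Set.compl_union]
    exact fun x hx => ⟨hVs ⟨hx.1, hx.2.1⟩, hWt ⟨hx.1, hx.2.2⟩⟩
  | compl s _ hs =>
    obtain ⟨V, hV, hZV, hVs⟩ := hs
    exact ⟨V, hV, hZV, by rw [compl_compl]; exact hVs.symm⟩

theorem exists_isOpen_closure_inter_subset_of_isConstructible {s : Set α} (hs : IsConstructible s)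
    (hirr : IsIrreducible s) : ∃ V, IsOpen V ∧ (s ∩ V).Nonempty ∧ closure s ∩ V ⊆ s := by
  obtain ⟨V, hV, ⟨z, hz, hzV⟩, hVs⟩ := exists_isOpen_inter_subset_or_subset_compl hs hirr.closure
  obtain ⟨x, hxV, hxs⟩ := mem_closure_iff.1 hz V hV hzV
  exact ⟨V, hV, ⟨x, hxs, hxV⟩, hVs.resolve_right fun h => h ⟨subset_closure hxs, hxV⟩ hxs⟩

theorem isConstructible_of_isClosed [NoetherianSpace α] {s : Set α} (hs : IsClosed s) :
    IsConstructible s :=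
  isConstructible_compl.1 ((NoetherianSpace.isCompact sᶜ).isConstructible hs.isOpen_compl)

theorem smul_set_eq_of_subset_of_isClosed {Γ : Type*} [Group Γ] [MulAction Γ α]
    [ContinuousConstSMul Γ α] [NoetherianSpace α] {g : Γ} {Z : Set α} (hZ : IsClosed Z)
    (hgZ : g • Z ⊆ Z) : g • Z = Z := by
  lift Z to Closeds α using hZ
  induction Z using WellFoundedLT.induction with
  | ind Z ih =>
    by_contra hne
    let gZ : Closeds α := ⟨g • (Z : Set α), Z.isClosed.smul g⟩
    have hlt : gZ < Z := lt_of_le_of_ne hgZ fun h => hne (congrArg SetLike.coe h)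
    exact hne (smul_left_cancel g (ih gZ hlt (Set.smul_set_mono hgZ)))

theorem isIrreducible_image2_of_separately_continuous {f : α → β → γ} {s : Set α} {t : Set β}
    (hs : IsIrreducible s) (ht : IsIrreducible t) (hf_left : ∀ b, Continuous fun a => f a b)
    (hf_right : ∀ a, Continuous (f a)) : IsIrreducible (Set.image2 f s t) := by
  refine ⟨hs.nonempty.image2 ht.nonempty, ?_⟩
  rintro U V hU hV ⟨_, ⟨a, ha, b, hb, rfl⟩, hab⟩ ⟨_, ⟨a', ha', b', hb', rfl⟩, hab'⟩
  obtain ⟨c, hc, hcU, hcV⟩ := ht.isPreirreducible _ _ (hU.preimage (hf_right a))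
    (hV.preimage (hf_right a')) ⟨b, hb, hab⟩ ⟨b', hb', hab'⟩
  obtain ⟨d, hd, hdU, hdV⟩ := hs.isPreirreducible _ _ (hU.preimage (hf_left c))
    (hV.preimage (hf_left c)) ⟨a, ha, hcU⟩ ⟨a', ha', hcV⟩
  exact ⟨f d c, Set.mem_image2_of_mem hd hc, hdU, hdV⟩

theorem exists_forall_subset_closure_of_directedOn [WellFoundedGT (IrreducibleCloseds α)]
    {ι : Type*} {f : ι → Set α} {c : Set ι} (hc : c.Nonempty)
    (hdir : DirectedOn (fun i j => f i ⊆ f j) c) (hirr : ∀ i ∈ c, IsIrreducible (f i)) :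
    ∃ i ∈ c, ∀ j ∈ c, f j ⊆ closure (f i) := by
  let Z (i : c) : IrreducibleCloseds α := ⟨closure (f i), (hirr i i.2).closure, isClosed_closure⟩
  have : Nonempty c := hc.to_subtype
  obtain ⟨_, ⟨⟨i, hi⟩, rfl⟩, hmax⟩ := wellFounded_gt.has_min (Set.range Z) (Set.range_nonempty Z)
  refine ⟨i, hi, fun j hj => ?_⟩
  obtain ⟨l, hl, hil, hjl⟩ := hdir i hi j hj
  have hZ : Z ⟨i, hi⟩ = Z ⟨l, hl⟩ :=
    LE.le.eq_of_not_lt (closure_mono hil) (hmax _ ⟨⟨l, hl⟩, rfl⟩)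
  exact (hjl.trans subset_closure).trans (congrArg SetLike.coe hZ).ge

theorem isClosed_noetherian_induction [NoetherianSpace α] {P : Set α → Prop} (empty : P ∅)
    (union : ∀ s t, P s → P t → P (s ∪ t))
    (inter : ∀ Z, IsClosed Z → IsIrreducible Z → ∃ V, IsOpen V ∧ (Z ∩ V).Nonempty ∧ P (Z ∩ V))
    {C : Set α} (hC : IsClosed C) : P C := by
  lift C to Closeds α using hC
  induction C using WellFoundedLT.induction with
  | ind C ih =>
    rcases (C : Set α).eq_empty_or_nonempty with hempty | hne
    · rwa [hempty]
    by_cases hirr : IsPreirreducible (C : Set α)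
    · obtain ⟨V, hV, ⟨x, hxC, hxV⟩, hPV⟩ := inter C C.isClosed ⟨hne, hirr⟩
      let D : Closeds α := ⟨C \ V, C.isClosed.sdiff hV⟩
      have hD : D < C := SetLike.lt_iff_le_and_exists.2 ⟨fun _ h => h.1, x, hxC, fun h => h.2 hxV⟩
      exact Set.inter_union_sdiff (C : Set α) V ▸ union _ _ hPV (ih D hD)
    · simp only [isPreirreducible_iff_isClosed_union_isClosed, not_forall, not_or] at hirr
      obtain ⟨A, B, hA, hB, hAB, hCA, hCB⟩ := hirr
      let CA : Closeds α := C ⊓ ⟨A, hA⟩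
      let CB : Closeds α := C ⊓ ⟨B, hB⟩
      have hunion : (CA ∪ CB : Set α) = C := by
        rw [Closeds.coe_inf, Closeds.coe_inf, ← Set.inter_union_distrib_left]
        exact Set.inter_eq_left.2 hAB
      exact hunion ▸ union _ _ (ih CA (inf_lt_left.2 hCA)) (ih CB (inf_lt_left.2 hCB))

end Topology

/-! ## The Zariski topology on points -/

theorem wellFoundedGT_irreducibleCloseds (B : Scheme.{u}) [IsLocallyNoetherian B] :
    WellFoundedGT (IrreducibleCloseds B) := by
  have hfin (b : B) : Order.coheight b < ⊤ := by
    rw [← WithBot.coe_lt_coe, ← ringKrullDim_stalk_eq_coheight]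
    exact ringKrullDim_lt_top
  have hanti : StrictAnti (Order.coheight (α := B)) := fun b c hbc =>
    Order.coheight_strictAnti hbc (hfin _)
  have : WellFoundedGT B := hanti.wellFoundedGT
  exact (irreducibleSetEquivPoints (α := B)).strictMono.wellFoundedGT

namespace Pt

section Field

variable {k : Type u} [Field k] {A B : Over (Spec (.of k))}

theorem toPoint_comp (x : Pt A) (f : A ⟶ B) : toPoint (x ≫ f) = f.left x.toPoint :=
  Scheme.Hom.comp_apply x.left f.left _

theorem isInducing_toPoint : IsInducing (toPoint (X := A)) := ⟨rfl⟩

theorem continuous_comp (f : A ⟶ B) : Continuous fun x : Pt A => x ≫ f := by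
  rw [isInducing_toPoint.continuous_iff]
  refine (f.left.continuous.comp isInducing_toPoint.continuous).congr fun x => ?_
  exact (toPoint_comp x f).symm

theorem continuous_lift_left (b : Pt B) : Continuous fun a : Pt A => lift a b := by
  refine (continuous_comp (lift (𝟙 A) (toUnit A ≫ b))).congr fun a => ?_
  rw [comp_lift, Category.comp_id, ← Category.assoc, toUnit_unique (a ≫ toUnit A) (𝟙 _)]
  exact congrArg _ (Category.id_comp b)

theorem continuous_lift_right (a : Pt A) : Continuous fun b : Pt B => lift a b := by
  refine (continuous_comp (lift (toUnit B ≫ a) (𝟙 B))).congr fun b => ?_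
  rw [comp_lift, Category.comp_id, ← Category.assoc, toUnit_unique (b ≫ toUnit B) (𝟙 _)]
  exact congrArg (lift · b) (Category.id_comp a)

instance instContinuousConstSMul : ContinuousConstSMul (Aut A) (Pt A) :=
  ⟨fun g => continuous_comp g.hom⟩

theorem continuous_lift_smul (g : Aut A) : Continuous fun x : Pt A => lift x (g • x) := by
  refine (continuous_comp (lift (𝟙 A) g.hom)).congr fun x => ?_
  rw [comp_lift, Category.comp_id]
  rfl

theorem isNoetherian_left [LocallyOfFiniteType A.hom] [QuasiCompact A.hom] :
    AlgebraicGeometry.IsNoetherian A.left :=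
  have : CompactSpace A.left := QuasiCompact.compactSpace_of_compactSpace A.hom
  { __ := LocallyOfFiniteType.isLocallyNoetherian A.hom }

instance instNoetherianSpace [LocallyOfFiniteType A.hom] [QuasiCompact A.hom] :
    NoetherianSpace (Pt A) :=
  have : AlgebraicGeometry.IsNoetherian A.left := isNoetherian_left
  isInducing_toPoint.noetherianSpace

instance instWellFoundedGTIrreducibleCloseds [LocallyOfFiniteType A.hom] :
    WellFoundedGT (IrreducibleCloseds (Pt A)) :=
  have : IsLocallyNoetherian A.left := LocallyOfFiniteType.isLocallyNoetherian A.hom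
  have := wellFoundedGT_irreducibleCloseds A.left
  (IrreducibleCloseds.map_strictMono_of_isInducing isInducing_toPoint).wellFoundedGT

end Field

section IsAlgClosed

variable {k : Type u} [Field k] [IsAlgClosed k] {A B : Over (Spec (.of k))}
  [LocallyOfFiniteType A.hom]

theorem isClosed_singleton_toPoint (x : Pt A) : IsClosed {x.toPoint} :=
  (pointEquivClosedPoint A.hom ⟨x.left, Over.w x⟩).2

theorem toPoint_injective : Function.Injective (toPoint (X := A)) :=
  fun x y h => Over.OverMorphism.ext (ext_of_apply_closedPoint_eq A.hom (Over.w x) (Over.w y) h)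

theorem exists_toPoint_mem {S : Set A.left} (hS : S.Nonempty) (hS' : IsLocallyClosed S) :
    ∃ x : Pt A, x.toPoint ∈ S := by
  have : JacobsonSpace A.left := LocallyOfFiniteType.jacobsonSpace (Y := Spec _) A.hom
  obtain ⟨a, haS, ha⟩ := nonempty_inter_closedPoints hS hS'
  let x : Pt A := Over.homMk (pointOfClosedPoint A.hom a ha) (pointOfClosedPoint_comp A.hom a ha)
  have hx : x.toPoint = a := pointOfClosedPoint_apply A.hom a ha (IsLocalRing.closedPoint k)
  exact ⟨x, hx ▸ haS⟩

instance instIrreducibleSpace [IrreducibleSpace A.left] : IrreducibleSpace (Pt A) where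
  toNonempty := ⟨(exists_toPoint_mem Set.univ_nonempty isOpen_univ.isLocallyClosed).choose⟩
  isPreirreducible_univ := by
    rintro _ _ ⟨U, hU, rfl⟩ ⟨V, hV, rfl⟩ ⟨u, -, hu⟩ ⟨v, -, hv⟩
    obtain ⟨x, hx⟩ := exists_toPoint_mem
      (nonempty_preirreducible_inter hU hV ⟨_, hu⟩ ⟨_, hv⟩) (hU.inter hV).isLocallyClosed
    exact ⟨x, trivial, hx⟩

theorem image_comp_preimage_toPoint [LocallyOfFiniteType B.hom] (f : A ⟶ B) {C : Set A.left}
    (hC : IsLocallyClosed C) :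
    (fun x : Pt A => x ≫ f) '' (toPoint ⁻¹' C) = toPoint ⁻¹' (f.left '' C) := by
  ext y
  constructor
  · rintro ⟨x, hx, rfl⟩
    exact ⟨x.toPoint, hx, (toPoint_comp x f).symm⟩
  · rintro ⟨a, ha, hay⟩
    have hfiber : IsClosed (f.left ⁻¹' {toPoint y}) :=
      (isClosed_singleton_toPoint y).preimage f.left.continuous
    obtain ⟨x, hxC, hxy⟩ := exists_toPoint_mem (S := C ∩ f.left ⁻¹' {toPoint y}) ⟨a, ha, hay⟩
      (hC.inter hfiber.isLocallyClosed)
    exact ⟨x, hxC, toPoint_injective ((toPoint_comp x f).trans hxy)⟩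

theorem isConstructible_image_comp [QuasiCompact A.hom] [LocallyOfFiniteType B.hom]
    [QuasiCompact B.hom] (f : A ⟶ B) {S : Set (Pt A)} (hS : IsClosed S) :
    IsConstructible ((fun x : Pt A => x ≫ f) '' S) := by
  have : AlgebraicGeometry.IsNoetherian A.left := isNoetherian_left
  have : AlgebraicGeometry.IsNoetherian B.left := isNoetherian_left
  have : LocallyOfFiniteType (f.left ≫ B.hom) := by rwa [Over.w]
  have : LocallyOfFiniteType f.left := locallyOfFiniteType_of_comp f.left B.hom
  have : LocallyOfFinitePresentation f.left :=
    LocallyOfFinitePresentation.iff_locallyOfFiniteType.2 this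
  obtain ⟨C, hC, rfl⟩ := isInducing_toPoint.isClosed_iff.1 hS
  rw [image_comp_preimage_toPoint f hC.isLocallyClosed]
  exact (f.left.isConstructible_image (isConstructible_of_isClosed hC)).preimage
    isInducing_toPoint.continuous fun U hU _ =>
      (NoetherianSpace.isCompact _).isRetrocompact (hU.preimage isInducing_toPoint.continuous)

end IsAlgClosed

end Pt

/-! ## Products of families -/

namespace Family

section Field

variable {k : Type u} [Field k] {X : Over (Spec (.of k))}

theorem IsUnital.inverse {F : Family X} (hF : F.IsUnital) : F.inverse.IsUnital := by
  obtain ⟨t, ht⟩ := hF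
  exact ⟨t, inv_eq_one.2 ht⟩

theorem range_inverse (F : Family X) : Set.range F.inverse.φ = (Set.range F.φ)⁻¹ :=
  (Set.image_inv_eq_inv (s := Set.range F.φ)) ▸ Set.range_comp Inv.inv F.φ

/-- The collection consisting of the members of `I` and their inverses. It is phrased as in
`IsDerivedFrom`, so that `F.IsDerivedFrom I` unfolds to `IsProductOf (withInverses I) F`. -/
def withInverses (I : Set (Family X)) : Set (Family X) := {H | H ∈ I ∨ ∃ H' ∈ I, H = H'.inverse}

theorem subset_withInverses (I : Set (Family X)) : I ⊆ withInverses I := fun _ => .inl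

theorem isUnital_of_mem_withInverses {I : Set (Family X)} (hI : ∀ F ∈ I, F.IsUnital) :
    ∀ F ∈ withInverses I, F.IsUnital := by
  rintro _ (hF | ⟨F, hF, rfl⟩)
  · exact hI _ hF
  · exact (hI F hF).inverse

theorem closure_withInverses (I : Set (Family X)) :
    Submonoid.closure (⋃ H ∈ withInverses I, Set.range H.φ) = (generatedGroup I).toSubmonoid := by
  have hrange : ⋃ H ∈ withInverses I, Set.range H.φ =
      (⋃ F ∈ I, Set.range F.φ) ∪ (⋃ F ∈ I, Set.range F.φ)⁻¹ := by
    have himage : withInverses I = I ∪ inverse '' I := by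
      ext H
      simp only [withInverses, Set.mem_ofPred_eq, Set.mem_union, Set.mem_image, eq_comm]
    rw [himage, Set.biUnion_union, Set.biUnion_image]
    simp only [range_inverse, Set.iUnion_inv]
  rw [hrange, generatedGroup, Subgroup.closure_toSubmonoid]

theorem IsExhaustive.mono {G : Subgroup (Aut X)} {Y Y' : Set (Pt X)} {F : Family X}
    (hF : F.IsExhaustive G Y') (hY : Y ⊆ Y') : F.IsExhaustive G Y :=
  ⟨hF.1, fun y hy => hF.2 y (hY hy)⟩

theorem isExhaustive_of_forall_exists {G : Subgroup (Aut X)} {Y : Set (Pt X)} {F : Family X}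
    (hFG : Set.range F.φ ⊆ G) (hF : ∀ y ∈ Y, ∀ g ∈ G, ∃ s ∈ Set.range F.φ, s • y = g • y) :
    F.IsExhaustive G Y := by
  refine ⟨Set.range_subset_iff.1 hFG, fun y hy => Set.Subset.antisymm ?_ ?_⟩
  · rintro _ ⟨g, rfl⟩
    exact hF y hy g g.2
  · rintro _ ⟨g, hg, rfl⟩
    exact ⟨⟨g, hFG hg⟩, rfl⟩

theorem IsExhaustive.of_range_subset {G : Subgroup (Aut X)} {Y : Set (Pt X)} {F F' : Family X}
    (hF : F.IsExhaustive G Y) (hFF' : Set.range F.φ ⊆ Set.range F'.φ) (hF' : Set.range F'.φ ⊆ G) :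
    F'.IsExhaustive G Y :=
  isExhaustive_of_forall_exists hF' fun y hy g hg =>
    Set.image_mono hFF' (hF.2 y hy ▸ ⟨⟨g, hg⟩, rfl⟩)

theorem IsExhaustive.union {G : Subgroup (Aut X)} {Y Y' : Set (Pt X)} {F : Family X}
    (hY : F.IsExhaustive G Y) (hY' : F.IsExhaustive G Y') : F.IsExhaustive G (Y ∪ Y') :=
  ⟨hY.1, fun y hy => hy.elim (hY.2 y) (hY'.2 y)⟩

end Field

section Products

variable {k : Type u} [Field k] [IsAlgClosed k] {X : Over (Spec (.of k))}

theorem range_prod (F F' : Family X) :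
    Set.range (F.prod F').φ = Set.range F.φ * Set.range F'.φ := by
  ext g
  constructor
  · rintro ⟨p, rfl⟩
    exact Set.mul_mem_mul ⟨p ≫ fst _ _, rfl⟩ ⟨p ≫ snd _ _, rfl⟩
  · rintro ⟨_, ⟨t, rfl⟩, _, ⟨s, rfl⟩, rfl⟩
    refine ⟨lift t s, ?_⟩
    change F.φ (lift t s ≫ fst _ _) * F'.φ (lift t s ≫ snd _ _) = _
    rw [lift_fst, lift_snd]

theorem range_seqProd (F : Family X) (l : List (Family X)) :
    Set.range (seqProd F l).φ = ((F :: l).map fun H => Set.range H.φ).prod := by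
  induction l generalizing F with
  | nil => exact (List.prod_singleton (x := Set.range F.φ)).symm
  | cons H l ih => exact (range_prod F _).trans (by rw [ih, ← List.prod_cons]; rfl)

theorem IsUnital.prod {F F' : Family X} (hF : F.IsUnital) (hF' : F'.IsUnital) :
    (F.prod F').IsUnital := by
  rw [IsUnital, range_prod]
  exact ⟨1, hF, 1, hF', one_mul 1⟩

theorem IsAlgebraic.prod {F F' : Family X} (hF : F.IsAlgebraic) (hF' : F'.IsAlgebraic) :
    (F.prod F').IsAlgebraic := by
  obtain ⟨Φ, hΦ⟩ := hF
  obtain ⟨Ψ, hΨ⟩ := hF'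
  have hlift (t : Pt F.T) (s : Pt F'.T) (x : Pt X) :
      lift (lift t s) x ≫ (α_ F.T F'.T X).hom ≫ F.T ◁ Ψ ≫ Φ = (F.φ t * F'.φ s) • x := by
    rw [mul_smul, ← hΨ, ← hΦ, ← Category.assoc, lift_lift_associator_hom, ← Category.assoc,
      lift_whiskerLeft]
  refine ⟨(α_ F.T F'.T X).hom ≫ F.T ◁ Ψ ≫ Φ, fun (p : Pt (F.T ⊗ F'.T)) x => ?_⟩
  refine Eq.trans ?_ (hlift (p ≫ fst _ _) (p ≫ snd _ _) x)
  rw [lift_comp_fst_snd]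
  rfl

/-- `F` is the product of a nonempty finite sequence of members of `J`. Unlike for
`IsDerivedFrom J`, inverses are not allowed, so that the product is algebraic when the members of
`J` are. -/
def IsProductOf (J : Set (Family X)) (F : Family X) : Prop :=
  ∃ (F₀ : Family X) (l : List (Family X)), (∀ H ∈ F₀ :: l, H ∈ J) ∧ F = seqProd F₀ l

namespace IsProductOf

variable {J : Set (Family X)} {F F' : Family X}

theorem of_mem (hF : F ∈ J) : IsProductOf J F :=
  ⟨F, [], List.forall_mem_singleton.2 hF, rfl⟩

theorem mono {J' : Set (Family X)} (hF : IsProductOf J F) (hJ : J ⊆ J') : IsProductOf J' F :=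
  let ⟨F₀, l, hl, h⟩ := hF
  ⟨F₀, l, fun H hH => hJ (hl H hH), h⟩

theorem exists_range_eq_mul (hF : IsProductOf J F) (hF' : IsProductOf J F') :
    ∃ F'', IsProductOf J F'' ∧ Set.range F''.φ = Set.range F.φ * Set.range F'.φ := by
  obtain ⟨F₀, l, hl, rfl⟩ := hF
  obtain ⟨F₀', l', hl', rfl⟩ := hF'
  refine ⟨seqProd F₀ (l ++ F₀' :: l'), ⟨F₀, l ++ F₀' :: l', ?_, rfl⟩, ?_⟩
  · rw [← List.cons_append]
    exact List.forall_mem_append.2 ⟨hl, hl'⟩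
  · rw [range_seqProd, range_seqProd, range_seqProd, ← List.cons_append, List.map_append,
      List.prod_append]

theorem induction {P : Family X → Prop} (mem : ∀ F ∈ J, P F)
    (prod : ∀ F ∈ J, ∀ F', P F' → P (F.prod F')) (hF : IsProductOf J F) : P F := by
  obtain ⟨F₀, l, hl, rfl⟩ := hF
  induction l generalizing F₀ with
  | nil => exact mem F₀ (List.forall_mem_singleton.1 hl)
  | cons H l ih =>
    rw [List.forall_mem_cons] at hl
    exact prod F₀ hl.1 _ (ih H hl.2)

theorem isAlgebraic (hJ : ∀ H ∈ J, H.IsAlgebraic) (hF : IsProductOf J F) : F.IsAlgebraic :=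
  hF.induction hJ fun H hH _ => (hJ H hH).prod

theorem isUnital (hJ : ∀ H ∈ J, H.IsUnital) (hF : IsProductOf J F) : F.IsUnital :=
  hF.induction hJ fun H hH _ => (hJ H hH).prod

theorem directedOn_range_subset (hJ : ∀ H ∈ J, H.IsUnital) :
    DirectedOn (fun F F' : Family X => Set.range F.φ ⊆ Set.range F'.φ) {F | IsProductOf J F} := by
  intro F hF F' hF'
  obtain ⟨F'', hF'', hrange⟩ := exists_range_eq_mul hF hF'
  refine ⟨F'', hF'', ?_, ?_⟩
  · exact (Set.subset_mul_left _ (isUnital hJ hF')).trans hrange.ge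
  · exact (Set.subset_mul_right _ (isUnital hJ hF)).trans hrange.ge

theorem range_subset (hF : IsProductOf J F) :
    Set.range F.φ ⊆ Submonoid.closure (⋃ H ∈ J, Set.range H.φ) := by
  have hmem : ∀ H ∈ J, Set.range H.φ ⊆ Submonoid.closure (⋃ H ∈ J, Set.range H.φ) := fun H hH =>
    (Set.subset_biUnion_of_mem (u := fun H : Family X => Set.range H.φ) hH).trans
      Submonoid.subset_closure
  refine hF.induction hmem fun H hH F' hF' => ?_
  rw [range_prod]
  exact Submonoid.mul_subset (hmem H hH) hF'

end IsProductOf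

theorem exists_isProductOf_mem_range {J : Set (Family X)} (hne : J.Nonempty)
    (hJ : ∀ H ∈ J, H.IsUnital) {g : Aut X}
    (hg : g ∈ Submonoid.closure (⋃ H ∈ J, Set.range H.φ)) :
    ∃ F, IsProductOf J F ∧ g ∈ Set.range F.φ := by
  induction hg using Submonoid.closure_induction with
  | mem g hg =>
    obtain ⟨F, hF, hg⟩ := Set.mem_iUnion₂.1 hg
    exact ⟨F, .of_mem hF, hg⟩
  | one =>
    obtain ⟨F, hF⟩ := hne
    exact ⟨F, .of_mem hF, hJ F hF⟩
  | mul g h _ _ hg hh =>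
    obtain ⟨F, hF, hg⟩ := hg
    obtain ⟨F', hF', hh⟩ := hh
    obtain ⟨F'', hF'', hrange⟩ := hF.exists_range_eq_mul hF'
    exact ⟨F'', hF'', hrange ▸ Set.mul_mem_mul hg hh⟩

theorem exists_isProductOf_subset_range {J : Set (Family X)} (hne : J.Nonempty)
    (hJ : ∀ H ∈ J, H.IsUnital) {s : Set (Aut X)} (hs : s.Finite)
    (hsJ : s ⊆ Submonoid.closure (⋃ H ∈ J, Set.range H.φ)) :
    ∃ F, IsProductOf J F ∧ s ⊆ Set.range F.φ := by
  lift s to Finset (Aut X) using hs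
  refine (IsProductOf.directedOn_range_subset hJ).exists_mem_subset_of_finset_subset_biUnion
    (hne.imp fun _ => .of_mem) fun g hg => ?_
  obtain ⟨F, hF, hg⟩ := exists_isProductOf_mem_range hne hJ (hsJ hg)
  exact Set.mem_biUnion hF hg

end Products

end Family

/-! ## Graphs of families -/

section Graph

variable {k : Type u} [Field k] {X : Over (Spec (.of k))}

/-- The union of the graphs of the restrictions to `U` of the members of `S`, as a set of points of
`X × X`. -/
noncomputable def graphOn (S : Set (Aut X)) (U : Set (Pt X)) : Set (Pt (X ⊗ X)) :=
  Set.image2 (fun g x => lift x (g • x)) S U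

theorem lift_mem_graphOn {S : Set (Aut X)} {U : Set (Pt X)} {y z : Pt X} :
    lift y z ∈ graphOn S U ↔ y ∈ U ∧ ∃ s ∈ S, s • y = z := by
  constructor
  · rintro ⟨g, hg, x, hx, hgx⟩
    obtain ⟨rfl, rfl⟩ : x = y ∧ g • x = z :=
      ⟨by simpa only [lift_fst] using congrArg (· ≫ fst X X) hgx,
        by simpa only [lift_snd] using congrArg (· ≫ snd X X) hgx⟩
    exact ⟨hx, g, hg, rfl⟩
  · rintro ⟨hy, s, hs, rfl⟩
    exact Set.mem_image2_of_mem hs hy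

/-- The action of `Aut(X)` on the second factor of `X × X`: `g` acts by `(x, y) ↦ (x, g(y))`. -/
noncomputable def autSnd (X : Over (Spec (.of k))) : Aut X →* Aut (X ⊗ X) := (tensorLeft X).mapAut X

theorem autSnd_smul_lift (g : Aut X) (x y : Pt X) : autSnd X g • lift x y = lift x (g • y) :=
  lift_whiskerLeft x y g.hom

theorem autSnd_smul_graphOn (g : Aut X) (S : Set (Aut X)) (U : Set (Pt X)) :
    autSnd X g • graphOn S U = graphOn (g • S) U := by
  rw [graphOn, graphOn, ← Set.image_smul, ← Set.image_smul, Set.image_image2,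
    Set.image2_image_left]
  simp only [autSnd_smul_lift, smul_eq_mul, mul_smul]

theorem Family.graphOn_range_eq_image {F : Family X} {Φ : F.T ⊗ X ⟶ X}
    (hΦ : ∀ (t : Pt F.T) (x : Pt X), lift t x ≫ Φ = F.φ t • x) (U : Set (Pt X)) :
    graphOn (Set.range F.φ) U =
      (fun p : Pt (F.T ⊗ X) => p ≫ lift (snd F.T X) Φ) '' {p | p ≫ snd F.T X ∈ U} := by
  ext q
  constructor
  · rintro ⟨_, ⟨t, rfl⟩, x, hx, rfl⟩
    refine ⟨lift t x, ?_, ?_⟩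
    · rwa [Set.mem_ofPred_eq, lift_snd]
    · beta_reduce
      rw [comp_lift, lift_snd, hΦ]
  · rintro ⟨p, hp, rfl⟩
    beta_reduce
    rw [comp_lift, lift_mem_graphOn]
    exact ⟨hp, _, ⟨p ≫ fst _ _, rfl⟩, by rw [← hΦ, lift_comp_fst_snd]⟩

instance locallyOfFiniteType_tensorObj {A B : Over (Spec (.of k))} [LocallyOfFiniteType A.hom]
    [LocallyOfFiniteType B.hom] : LocallyOfFiniteType (A ⊗ B).hom :=
  inferInstanceAs (LocallyOfFiniteType (pullback.fst A.hom B.hom ≫ A.hom))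

instance quasiCompact_tensorObj {A B : Over (Spec (.of k))} [QuasiCompact A.hom]
    [QuasiCompact B.hom] : QuasiCompact (A ⊗ B).hom :=
  inferInstanceAs (QuasiCompact (pullback.fst A.hom B.hom ≫ A.hom))

variable [IsAlgClosed k]

theorem Family.IsAlgebraic.isIrreducible_graphOn {F : Family X} (hF : F.IsAlgebraic)
    {U : Set (Pt X)} (hU : IsIrreducible U) : IsIrreducible (graphOn (Set.range F.φ) U) := by
  obtain ⟨Φ, hΦ⟩ := hF
  have := F.isVariety
  have := F.irreducible
  rw [graphOn, ← Set.image_univ, Set.image2_image_left]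
  refine isIrreducible_image2_of_separately_continuous
    (IrreducibleSpace.isIrreducible_univ (Pt F.T)) hU (fun x => ?_)
    fun t => Pt.continuous_lift_smul (F.φ t)
  simp only [← hΦ]
  exact (Pt.continuous_lift_right x).comp
    ((Pt.continuous_comp Φ).comp (Pt.continuous_lift_left x))

theorem Family.IsAlgebraic.isConstructible_graphOn [LocallyOfFiniteType X.hom]
    [QuasiCompact X.hom] {F : Family X} (hF : F.IsAlgebraic) {U : Set (Pt X)} (hU : IsClosed U) :
    IsConstructible (graphOn (Set.range F.φ) U) := by
  obtain ⟨Φ, hΦ⟩ := hF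
  have := F.isVariety
  rw [F.graphOn_range_eq_image hΦ]
  exact Pt.isConstructible_image_comp _ (hU.preimage (Pt.continuous_comp _))

end Graph

/-! ## Exhaustive families -/

namespace Family

section Exhaustion

variable {k : Type u} [Field k] [IsAlgClosed k] {X : Over (Spec (.of k))} {I : Set (Family X)}

theorem IsDerivedFrom.range_subset_generatedGroup {F : Family X} (hF : F.IsDerivedFrom I) :
    Set.range F.φ ⊆ generatedGroup I := by
  rw [← Subgroup.coe_toSubmonoid, ← closure_withInverses]
  exact IsProductOf.range_subset hF

theorem exists_isDerivedFrom_isExhaustive_union (hI : ∀ F ∈ I, F.IsUnital) {Y Y' : Set (Pt X)}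
    (hY : ∃ F : Family X, F.IsDerivedFrom I ∧ F.IsExhaustive (generatedGroup I) Y)
    (hY' : ∃ F : Family X, F.IsDerivedFrom I ∧ F.IsExhaustive (generatedGroup I) Y') :
    ∃ F : Family X, F.IsDerivedFrom I ∧ F.IsExhaustive (generatedGroup I) (Y ∪ Y') := by
  obtain ⟨F, hF, hFY⟩ := hY
  obtain ⟨F', hF', hFY'⟩ := hY'
  obtain ⟨F'', hF'', hle, hle'⟩ :=
    IsProductOf.directedOn_range_subset (isUnital_of_mem_withInverses hI) F hF F' hF'
  have hsub : Set.range F''.φ ⊆ generatedGroup I :=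
    IsDerivedFrom.range_subset_generatedGroup hF''
  exact ⟨F'', hF'', (hFY.of_range_subset hle hsub).union (hFY'.of_range_subset hle' hsub)⟩

theorem exists_forall_graphOn_subset_closure [LocallyOfFiniteType X.hom] (hne : I.Nonempty)
    (hI : ∀ F ∈ I, F.IsUnital ∧ F.IsAlgebraic) {U : Set (Pt X)} (hU : IsIrreducible U) :
    ∃ F₀, IsProductOf I F₀ ∧ ∀ F, IsProductOf I F →
      graphOn (Set.range F.φ) U ⊆ closure (graphOn (Set.range F₀.φ) U) := by
  have hdir := IsProductOf.directedOn_range_subset fun F hF => (hI F hF).1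
  exact exists_forall_subset_closure_of_directedOn
    (f := fun F : Family X => graphOn (Set.range F.φ) U) (c := {F | IsProductOf I F})
    (hne.imp fun _ => .of_mem) (hdir.mono' fun _ _ _ _ h => Set.image2_subset_right h)
    fun F hF => (IsProductOf.isAlgebraic (fun H hH => (hI H hH).2) hF).isIrreducible_graphOn hU

theorem autSnd_smul_closure_graphOn [LocallyOfFiniteType X.hom] [QuasiCompact X.hom]
    {U : Set (Pt X)} {F₀ : Family X} (hF₀ : IsProductOf I F₀)
    (hdense : ∀ F, IsProductOf I F →
      graphOn (Set.range F.φ) U ⊆ closure (graphOn (Set.range F₀.φ) U))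
    {g : Aut X} (hg : g ∈ generatedGroup I) :
    autSnd X g • closure (graphOn (Set.range F₀.φ) U) = closure (graphOn (Set.range F₀.φ) U) := by
  set Z := closure (graphOn (Set.range F₀.φ) U)
  suffices hle : generatedGroup I ≤
      (MulAction.stabilizer (Aut (X ⊗ X)) Z).comap (autSnd X) from hle hg
  refine (Subgroup.closure_le _).2 (Set.iUnion₂_subset fun F hF h hh => ?_)
  obtain ⟨F', hF', hrange⟩ := (IsProductOf.of_mem hF).exists_range_eq_mul hF₀
  have hsub : h • Set.range F₀.φ ⊆ Set.range F'.φ := hrange ▸ Set.smul_set_subset_mul hh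
  refine smul_set_eq_of_subset_of_isClosed isClosed_closure
    ((smul_closure_subset _ _).trans (closure_minimal ?_ isClosed_closure))
  rw [autSnd_smul_graphOn]
  exact (Set.image2_subset_right hsub).trans (hdense F' hF')

theorem exists_inter_iUnion_smul_subset_graphOn [LocallyOfFiniteType X.hom] [QuasiCompact X.hom]
    (hne : I.Nonempty) (hI : ∀ F ∈ I, F.IsUnital) {Z W : Set (Pt (X ⊗ X))}
    (hZ : ∀ g ∈ generatedGroup I, autSnd X g • Z = Z) (hW : IsOpen W) {U : Set (Pt X)}
    {F₀ : Family X} (hF₀ : F₀.IsDerivedFrom I) (hZW : Z ∩ W ⊆ graphOn (Set.range F₀.φ) U) :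
    ∃ F : Family X, F.IsDerivedFrom I ∧
      Z ∩ ⋃ g ∈ generatedGroup I, autSnd X g • W ⊆ graphOn (Set.range F.φ) U := by
  obtain ⟨s, hsG, hsfin, hcover⟩ :=
    (NoetherianSpace.isCompact (⋃ g ∈ (generatedGroup I : Set (Aut X)),
      autSnd X g • W)).elim_finite_subcover_image (fun g _ => hW.smul (autSnd X g)) subset_rfl
  obtain ⟨H, hH, hsH⟩ := exists_isProductOf_subset_range
    (hne.mono (subset_withInverses I)) (isUnital_of_mem_withInverses hI) hsfin
    (closure_withInverses I ▸ hsG)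
  obtain ⟨F, hF, hrange⟩ := IsProductOf.exists_range_eq_mul hH hF₀
  refine ⟨F, hF, fun p ⟨hpZ, hpW⟩ => ?_⟩
  obtain ⟨g, hgs, hpg⟩ := Set.mem_iUnion₂.1 (hcover hpW)
  have hp : p ∈ autSnd X g • (Z ∩ W) := by
    rw [Set.smul_set_inter, hZ g (hsG hgs)]
    exact ⟨hpZ, hpg⟩
  have hp' : p ∈ graphOn (g • Set.range F₀.φ) U :=
    autSnd_smul_graphOn g _ U ▸ Set.smul_set_mono hZW hp
  have hsub : g • Set.range F₀.φ ⊆ Set.range F.φ :=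
    hrange ▸ Set.smul_set_subset_mul (hsH hgs)
  exact Set.image2_subset_right hsub hp'

theorem exists_isOpen_isExhaustive_inter [LocallyOfFiniteType X.hom] [QuasiCompact X.hom]
    (hne : I.Nonempty) (hI : ∀ F ∈ I, F.IsUnital ∧ F.IsAlgebraic) {U : Set (Pt X)}
    (hUc : IsClosed U) (hU : IsIrreducible U) :
    ∃ V, IsOpen V ∧ (U ∩ V).Nonempty ∧
      ∃ F : Family X, F.IsDerivedFrom I ∧ F.IsExhaustive (generatedGroup I) (U ∩ V) := by
  have hIu (F) (hF : F ∈ I) : F.IsUnital := (hI F hF).1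
  obtain ⟨F₀, hF₀, hdense⟩ := exists_forall_graphOn_subset_closure hne hI hU
  have hF₀I : F₀.IsDerivedFrom I := hF₀.mono (subset_withInverses I)
  have hF₀alg : F₀.IsAlgebraic := hF₀.isAlgebraic fun F hF => (hI F hF).2
  have hstable (g) := autSnd_smul_closure_graphOn hF₀ hdense (g := g)
  obtain ⟨W, hW, ⟨_, ⟨g₀, hg₀, x₀, hx₀, rfl⟩, hx₀W⟩, hWF₀⟩ :=
    exists_isOpen_closure_inter_subset_of_isConstructible
      (hF₀alg.isConstructible_graphOn hUc) (hF₀alg.isIrreducible_graphOn hU)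
  obtain ⟨F, hF, hgraph⟩ := exists_inter_iUnion_smul_subset_graphOn hne hIu hstable hW hF₀I hWF₀
  refine ⟨{x | lift x (g₀ • x) ∈ W}, hW.preimage (Pt.continuous_lift_smul g₀), ⟨x₀, hx₀, hx₀W⟩,
    F, hF, isExhaustive_of_forall_exists hF.range_subset_generatedGroup ?_⟩
  rintro y ⟨hyU, hyW⟩ g hg
  have hclosure : lift y (g • y) ∈ closure (graphOn (Set.range F₀.φ) U) := by
    rw [← hstable g hg, ← autSnd_smul_lift]
    exact Set.smul_mem_smul_set (subset_closure
      (lift_mem_graphOn.2 ⟨hyU, 1, hF₀.isUnital hIu, one_smul _ y⟩))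
  have hsmul : lift y (g • y) ∈ autSnd X (g * g₀⁻¹) • W := by
    rw [← inv_mul_cancel_right g g₀, mul_smul, ← autSnd_smul_lift, inv_mul_cancel_right]
    exact Set.smul_mem_smul_set hyW
  have hgg₀ : g * g₀⁻¹ ∈ generatedGroup I :=
    mul_mem hg (inv_mem (hF₀I.range_subset_generatedGroup hg₀))
  exact (lift_mem_graphOn.1 (hgraph ⟨hclosure, Set.mem_biUnion hgg₀ hsmul⟩)).2

end Exhaustion

end Family

end AutFamilies

theorem mainTheorem1_general {k : Type u} [Field k] [IsAlgClosed k] {X : Over (Spec (.of k))}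
    [LocallyOfFiniteType X.hom] [QuasiCompact X.hom] {I : Set (AutFamilies.Family X)}
    (hne : I.Nonempty) (hI : ∀ F ∈ I, F.IsUnital ∧ F.IsAlgebraic) :
    ∃ F : AutFamilies.Family X, F.IsDerivedFrom I ∧
      F.IsExhaustive (AutFamilies.Family.generatedGroup I) Set.univ := by
  have hIu (F) (hF : F ∈ I) : F.IsUnital := (hI F hF).1
  refine AutFamilies.isClosed_noetherian_induction
    (P := fun Y => ∃ F : AutFamilies.Family X, F.IsDerivedFrom I ∧
      F.IsExhaustive (AutFamilies.Family.generatedGroup I) Y) ?_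
    (fun _ _ => AutFamilies.Family.exists_isDerivedFrom_isExhaustive_union hIu)
    (fun _ => AutFamilies.Family.exists_isOpen_isExhaustive_inter hne hI) isClosed_univ
  obtain ⟨F, hF⟩ := hne
  have hFI : F.IsDerivedFrom I :=
    AutFamilies.Family.IsProductOf.of_mem (AutFamilies.Family.subset_withInverses I hF)
  exact ⟨F, hFI, AutFamilies.Family.isExhaustive_of_forall_exists
    hFI.range_subset_generatedGroup fun _ hy => hy.elim⟩

theorem mainTheorem1 {k : Type u} [Field k] [IsAlgClosed k]
    (X : Over (Spec (.of k))) [AutFamilies.IsVariety X] [IrreducibleSpace X.left]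
    (I : Set (AutFamilies.Family X)) (hne : I.Nonempty)
    (hI : ∀ F ∈ I, F.IsUnital ∧ F.IsAlgebraic)
    (G : Subgroup (Aut X)) (hG : G = AutFamilies.Family.generatedGroup I)
    (Y : Set (AutFamilies.Pt X)) (hY : IsLocallyClosed Y)
    (hYG : ∀ g ∈ G, ∀ y ∈ Y, g • y ∈ Y) :
    ∃ F : AutFamilies.Family X, F.IsDerivedFrom I ∧ F.IsExhaustive G Y := by
  subst hG
  obtain ⟨F, hF, hFX⟩ := mainTheorem1_general hne hI
  exact ⟨F, hF, hFX.mono (Set.subset_univ Y)⟩
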